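/- **Setting and notation.** All spaces $\mathbb R^s$ and all products carry the Euclidean norm; $\mathbb B$ is the closed unit ball. For $A\subset\mathbb R^s$ and $p\in A$, let $T_A(p)=\{w : \exists\, t_n\downarrow 0,\ w_n\to w,\ p+t_nw_n\in A\}$ be the tangent cone, $\widehat N_A(p)=\{v:\langle v,w\rangle\le 0\ \forall w\in T_A(p)\}$ the regular normal cone, and $N_A(p)=\{\lim v_n : v_n\in\widehat N_A(p_n),\ p_n\in A,\ p_n\to p\}$ the limiting normal cone. For a set-valued mapping $F:\mathbb R^n\rightrightarrows\mathbb R^m$ with graph $\operatorname{gph}F=\{(x,y): y\in F(x)\}$ and $(x,y)\in\operatorname{gph}F$, the limiting coderivative $D^*F(x,y):\mathbb R^m\rightrightarrows\mathbb R^n$ is given by $x^*\in D^*F(x,y)(y^*)\iff (x^*,-y^*)\in N_{\operatorname{gph}F}(x,y)$, and the regular coderivative $\widehat D^*F(x,y)$ is defined in the same way with $\widehat N$ in place of $N$. * $F$ is *semismooth\** at $p\in\operatorname{gph}F$ if for every $\epsilon>0$ there is $\delta>0$ with $|\langle v,q-p\rangle|\le\epsilon\|q-p\|\,\|v\|$ for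 all $q\in\operatorname{gph}F$ with $\|q-p\|\le\delta$ and all $v\in\widehat N_{\operatorname{gph}F}(q)$. * Let $\mathcal O_F$ be the set of points of $\operatorname{gph}F$ at which $T_{\operatorname{gph}F}$ is an $n$-dimensional linear subspace. $F$ has the *SCD property* at $(x,y)\in\operatorname{gph}F$ if there are an $m$-dimensional subspace $L^*\subset\mathbb R^m\times\mathbb R^n$ and points $(x_j,y_j)\in\mathcal O_F$ converging to $(x,y)$ such that the subspaces $\operatorname{gph}\widehat D^*F(x_j,y_j)$ converge to $L^*$ (that is, their orthogonal projections converge in operator norm). * $F$ has one of these two properties *around* a point of its graph if it has it at all points of $\operatorname{gph}F$ in some neighbourhood of that point. * A mapping $S:\mathbb R^l\rightrightarrows\mathbb R^k$ has the *Aubin property around* $(\bar x,\bar y)\in\operatorname{gph}S$ if there are $\kappa\ge0$ and neighbourhoods $V$ of $\bar x$ and $U$ of $\bar y$ with $S(x)\cap U\subset S(x')+\kappa\|x-x'\|\mathbb B$ for all $x,x'\in V$. It is *isolatedly calm around* $(\bar x,\bar y)$ if there are $\kappa\ge0$ and a neighbourhood $W$ of $(\bar x,\bar y)$ such that for every $(x,y)\in\operatorname{gph}S\cap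 W$ there is a neighbourhood $U$ of $y$ with $S(x')\cap U\subset\{y\}+\kappa\|x'-x\|\mathbb B$ for all $x'\in\mathbb R^l$. **Proposition.** Let $H:\mathbb R^l\times\mathbb R^k\rightrightarrows\mathbb R^k$, let $((\bar x,\bar y),0)\in\operatorname{gph}H$, and let $\operatorname{gph}H$ be locally closed around this point (its intersection with some closed neighbourhood of the point is closed). Let $\Sigma:\mathbb R^l\rightrightarrows\mathbb R^k$, $\Sigma(x)=\{y : 0\in H(x,y)\}$, be the implicit solution map. Assume that for all $w^*\in\mathbb R^k$, $u^*\in\mathbb R^l$, $$(u^*,0)\in D^*H\big((\bar x,\bar y),0\big)(w^*)\ \Longrightarrow\ w^*=0,\ u^*=0 .$$ Then $\Sigma$ has the Aubin property around $(\bar x,\bar y)$. If, moreover, $H$ has the SCD property around $((\bar x,\bar y),0)$ and is semismooth* around $((\bar x,\bar y),0)$, then $\Sigma$ is also isolatedly calm around $(\bar x,\bar y)$. -/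

import Mathlib

open Set Filter Topology

/-! ### Variational geometry of sets in finite-dimensional Euclidean spaces -/

section Geometry

variable {E : Type*} [NormedAddCommGroup E] [InnerProductSpace ℝ E]

/-- `A` is locally closed around `x`: its intersection with some closed neighbourhood of `x`
is a closed set. -/
def LocallyClosedAround (A : Set E) (x : E) : Prop :=
  ∃ W ∈ 𝓝 x, IsClosed W ∧ IsClosed (A ∩ W)

/-- The regular (Fréchet) normal cone: the negative polar of the Bouligand tangent cone. For `x ∈ A`,
Mathlib's `posTangentConeAt A x` is the Bouligand cone, i.e. the set of all `w` for which there are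
`t_n ↓ 0` and `w_n → w` with `x + t_n • w_n ∈ A`. -/
def regularNormalCone (A : Set E) (x : E) : Set E :=
  {v | ∀ w ∈ posTangentConeAt A x, inner ℝ v w ≤ 0}

/-- The limiting (Mordukhovich) normal cone: the outer limit of the regular normal cones at points
of `A` converging to `x`. -/
def limitingNormalCone (A : Set E) (x : E) : Set E :=
  {v | ∃ (p : ℕ → E) (q : ℕ → E), (∀ n, p n ∈ A) ∧ Tendsto p atTop (𝓝 x) ∧
    (∀ n, q n ∈ regularNormalCone A (p n)) ∧ Tendsto q atTop (𝓝 v)}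

/-- The semismooth* property of a set at one of its points. -/
def SemismoothStarSetAt (A : Set E) (x : E) : Prop :=
  ∀ ε > 0, ∃ δ > 0, ∀ p ∈ A ∩ Metric.closedBall x δ, ∀ v ∈ regularNormalCone A p,
    |inner ℝ v (p - x)| ≤ ε * ‖p - x‖ * ‖v‖

/-- The distance `‖P₁ - P₂‖` (operator norm) of two linear subspaces, where `Pᵢ` is the orthogonal
projection onto `Lᵢ`, as a map from the whole space into itself. -/
noncomputable def subspaceDist [FiniteDimensional ℝ E] (L₁ L₂ : Submodule ℝ E) : ℝ :=
  ‖L₁.starProjection - L₂.starProjection‖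

end Geometry

/-! ### Set-valued mappings

A set-valued mapping from `E` to `G` is a function `E → Set G`. Products carry the Euclidean norm
`‖(u, v)‖ = √(‖u‖² + ‖v‖²)`, i.e. they are `WithLp 2 (E × G)`. -/

section Multifunctions

variable {E G : Type*} [NormedAddCommGroup E] [InnerProductSpace ℝ E]
  [NormedAddCommGroup G] [InnerProductSpace ℝ G]

/-- The graph `{(x, y) | y ∈ F x}`. -/
def setGraph (F : E → Set G) : Set (WithLp 2 (E × G)) :=
  {p | p.snd ∈ F p.fst}

/-- The regular (Fréchet) coderivative of `F` at `(x, y)`, a set-valued mapping from `G` to `E`. -/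
def regularCoderivative (F : E → Set G) (x : E) (y : G) : G → Set E :=
  fun ystar => {xstar | WithLp.toLp 2 (xstar, -ystar) ∈
    regularNormalCone (setGraph F) (WithLp.toLp 2 (x, y))}

/-- The limiting (Mordukhovich) coderivative of `F` at `(x, y)`, a set-valued mapping from
`G` to `E`. -/
def limitingCoderivative (F : E → Set G) (x : E) (y : G) : G → Set E :=
  fun ystar => {xstar | WithLp.toLp 2 (xstar, -ystar) ∈
    limitingNormalCone (setGraph F) (WithLp.toLp 2 (x, y))}

/-- The points of the graph of `F` at which `F` is graphically smooth of dimension `dim E`: the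
tangent cone to the graph is a linear subspace of that dimension. -/
def graphSmoothPoints (F : E → Set G) : Set (WithLp 2 (E × G)) :=
  {p | p ∈ setGraph F ∧ ∃ L : Submodule ℝ (WithLp 2 (E × G)),
    Module.finrank ℝ L = Module.finrank ℝ E ∧
      (L : Set (WithLp 2 (E × G))) = posTangentConeAt (setGraph F) p}

/-- The subspace containing limiting coderivative of `F` at `(x, y)`: all `(dim G)`-dimensional
subspaces of `G × E` that are limits of the graphs of the regular coderivatives of `F` at points of
graphical smoothness converging to `(x, y)`. -/
def scLimitingCoderivative [FiniteDimensional ℝ E] [FiniteDimensional ℝ G]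
    (F : E → Set G) (x : E) (y : G) : Set (Submodule ℝ (WithLp 2 (G × E))) :=
  {L | Module.finrank ℝ L = Module.finrank ℝ G ∧
    ∃ (p : ℕ → WithLp 2 (E × G)) (M : ℕ → Submodule ℝ (WithLp 2 (G × E))),
      (∀ n, p n ∈ graphSmoothPoints F) ∧ Tendsto p atTop (𝓝 (WithLp.toLp 2 (x, y))) ∧
      (∀ n, (M n : Set (WithLp 2 (G × E))) =
        setGraph (regularCoderivative F (p n).fst (p n).snd)) ∧
      Tendsto (fun n => subspaceDist L (M n)) atTop (𝓝 0)}

/-- `F` has the SCD property at `(x, y)`. -/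
def SCDAt [FiniteDimensional ℝ E] [FiniteDimensional ℝ G]
    (F : E → Set G) (x : E) (y : G) : Prop :=
  (scLimitingCoderivative F x y).Nonempty

/-- `F` has the SCD property around `(x, y)`, i.e. at all points of its graph near `(x, y)`. -/
def SCDAround [FiniteDimensional ℝ E] [FiniteDimensional ℝ G]
    (F : E → Set G) (x : E) (y : G) : Prop :=
  ∃ W ∈ 𝓝 (WithLp.toLp 2 (x, y)), ∀ p ∈ setGraph F ∩ W, SCDAt F p.fst p.snd

/-- `F` is semismooth* around `(x, y)`, i.e. its graph is semismooth* at all its points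
near `(x, y)`. -/
def SemismoothStarAround (F : E → Set G) (x : E) (y : G) : Prop :=
  ∃ W ∈ 𝓝 (WithLp.toLp 2 (x, y)), ∀ p ∈ setGraph F ∩ W, SemismoothStarSetAt (setGraph F) p

/-- The Aubin property of `S` around `(x, y)`: there are `κ ≥ 0` and neighbourhoods `V` of `x` and
`U` of `y` with `S x₁ ∩ U ⊆ S x₂ + κ ‖x₁ - x₂‖ 𝔹` for all `x₁, x₂ ∈ V`, where `𝔹` is the closed
unit ball. -/
def AubinPropertyAround (S : E → Set G) (x : E) (y : G) : Prop :=
  ∃ κ : ℝ, 0 ≤ κ ∧ ∃ V ∈ 𝓝 x, ∃ U ∈ 𝓝 y, ∀ x₁ ∈ V, ∀ x₂ ∈ V,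
    ∀ y₁ ∈ S x₁ ∩ U, ∃ y₂ ∈ S x₂, ‖y₁ - y₂‖ ≤ κ * ‖x₁ - x₂‖

/-- Isolated calmness of `S` at `(x, y)` with constant `κ`: there is a neighbourhood `U` of `y` with
`S x' ∩ U ⊆ {y} + κ ‖x' - x‖ 𝔹` for all `x'`. -/
def IsolatedlyCalmAtWith (κ : ℝ) (S : E → Set G) (x : E) (y : G) : Prop :=
  ∃ U ∈ 𝓝 y, ∀ x' : E, ∀ y' ∈ S x' ∩ U, ‖y' - y‖ ≤ κ * ‖x' - x‖

/-- Isolated calmness of `S` around `(x, y)`: isolated calmness, with one common constant, at all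
points of the graph of `S` near `(x, y)`. -/
def IsolatedlyCalmAround (S : E → Set G) (x : E) (y : G) : Prop :=
  ∃ κ : ℝ, 0 ≤ κ ∧ ∃ W ∈ 𝓝 (WithLp.toLp 2 (x, y)), ∀ p ∈ setGraph S ∩ W,
    IsolatedlyCalmAtWith κ S p.fst p.snd

end Multifunctions

/-- The implicit solution map `x ↦ {y | 0 ∈ H (x, y)}` of the inclusion `0 ∈ H (x, y)`. -/
def implicitSolutionMap {X Y Z : Type*} [Zero Z] (H : WithLp 2 (X × Y) → Set Z) : X → Set Y :=
  fun x => {y | 0 ∈ H (WithLp.toLp 2 (x, y))}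

/-! Read geometrically, the coderivative condition says that a limiting normal to `setGraph H` at
the reference point with zero `y`-component vanishes. By compactness, `‖v‖ ≤ κ * ‖v.fst.snd‖` for
regular normals at all nearby graph points, hence also for limiting ones. Both conclusions follow
from this bound.

Aubin property (`exists_mem_fiber_of_regularNormalCone_bound`): given a solution `y₁` at `x₁`,
minimize over the graph the distance of `(x, z)` to `(x₂, 0)` plus a smoothed penalty `lam * ‖y -
y₁‖` with `κ * lam < 1`. If the minimizer missed `(x₂, 0)`, Fermat's rule would give a normal of
norm at least 1 with `y`-component at most `lam`, against the bound. So it is a solution at `x₂`,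
and comparing values bounds its distance to `y₁`.

Isolated calmness: an SCD subspace consists, up to a swap of components, of limiting normals. The
bound makes its `y`-projection injective, hence bijective by dimension, so some normal `v` at the
nearby point has `y`-component `y' - y`. Pairing `v` with the displacement produces `‖y' - y‖ ^ 2`,
which semismoothness* controls. -/

section Norms

variable {E F : Type*} [NormedAddCommGroup E] [NormedAddCommGroup F]

theorem LocallyClosedAround.exists_isClosed_inter_closedBall {A : Set E} {x : E}
    (h : LocallyClosedAround A x) {r : ℝ} (hr : 0 < r) :
    ∃ s > 0, s ≤ r ∧ IsClosed (A ∩ Metric.closedBall x s) := by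
  obtain ⟨W, hW, -, hcl⟩ := h
  obtain ⟨s, hs, hsW⟩ := Metric.nhds_basis_closedBall.mem_iff.1 hW
  refine ⟨min s r, lt_min hs hr, min_le_right _ _, ?_⟩
  have hsub : Metric.closedBall x (min s r) ⊆ W :=
    (Metric.closedBall_subset_closedBall (min_le_left _ _)).trans hsW
  have : A ∩ Metric.closedBall x (min s r) = (A ∩ W) ∩ Metric.closedBall x (min s r) := by
    rw [inter_assoc, inter_eq_self_of_subset_right hsub]
  rw [this]
  exact hcl.inter Metric.isClosed_closedBall

theorem norm_withLp_two_le (p : WithLp 2 (E × F)) : ‖p‖ ≤ ‖p.fst‖ + ‖p.snd‖ := by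
  have h := WithLp.prod_norm_sq_eq_of_L2 p
  refine le_of_sq_le_sq ?_ (by positivity)
  nlinarith [norm_nonneg p.fst, norm_nonneg p.snd]

theorem norm_fst_le_norm_withLp_two (p : WithLp 2 (E × F)) : ‖p.fst‖ ≤ ‖p‖ := by
  have h := WithLp.prod_norm_sq_eq_of_L2 p
  refine le_of_sq_le_sq ?_ (by positivity)
  nlinarith [sq_nonneg ‖p.snd‖]

theorem norm_toLp_toLp_zero_sub_le {X Y Z : Type*} [NormedAddCommGroup X]
    [NormedAddCommGroup Y] [NormedAddCommGroup Z] (x x' : X) (y y' : Y) :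
    ‖WithLp.toLp 2 (WithLp.toLp 2 (x, y), (0 : Z)) - WithLp.toLp 2 (WithLp.toLp 2 (x', y'), 0)‖ ≤
      ‖x - x'‖ + ‖y - y'‖ := by
  have h1 := norm_withLp_two_le
    (WithLp.toLp 2 (WithLp.toLp 2 (x, y), (0 : Z)) - WithLp.toLp 2 (WithLp.toLp 2 (x', y'), 0))
  have h2 := norm_withLp_two_le (WithLp.toLp 2 (x, y) - WithLp.toLp 2 (x', y'))
  simp only [WithLp.sub_fst, WithLp.sub_snd, WithLp.toLp_fst, WithLp.toLp_snd, sub_self, norm_zero, add_zero] at h1 h2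
  linarith

end Norms

/-! ### Regular normals: Fermat's rule and the uniform bound. -/

section NormalCones

variable {E F : Type*} [NormedAddCommGroup E] [InnerProductSpace ℝ E]
  [NormedAddCommGroup F] [InnerProductSpace ℝ F]

theorem smul_mem_regularNormalCone {A : Set E} {x v : E} {c : ℝ} (hc : 0 ≤ c)
    (hv : v ∈ regularNormalCone A x) : c • v ∈ regularNormalCone A x := by
  intro w hw
  rw [real_inner_smul_left]
  exact mul_nonpos_of_nonneg_of_nonpos hc (hv w hw)

/-- Fermat's rule: the negative gradient at a local minimizer on `A` is a regular normal. -/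
theorem IsLocalMinOn.mem_regularNormalCone {A : Set E} {x v : E} {f : E → ℝ} {f' : E →L[ℝ] ℝ}
    (h : IsLocalMinOn f A x) (hf : HasFDerivAt f f' x) (hv : ∀ w, inner ℝ v w = -f' w) :
    v ∈ regularNormalCone A x := by
  intro w hw
  have := h.hasFDerivWithinAt_nonneg hf.hasFDerivWithinAt hw
  rw [hv]
  linarith

/-- If a linear map vanishes at no nonzero limiting normal at `x`, then it is bounded below on the
regular normals at all points near `x`. -/
theorem exists_norm_le_of_regularNormalCone [FiniteDimensional ℝ E] {A : Set E} {x : E}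
    (π : E →L[ℝ] F) (h : ∀ v ∈ limitingNormalCone A x, π v = 0 → v = 0) :
    ∃ κ > 0, ∃ r > 0, ∀ q ∈ A, ‖q - x‖ < r → ∀ v ∈ regularNormalCone A q, ‖v‖ ≤ κ * ‖π v‖ := by
  by_contra! hcon
  have hn : ∀ n : ℕ, ∃ q ∈ A, ‖q - x‖ < 1 / ((n : ℝ) + 1) ∧
      ∃ v ∈ regularNormalCone A q, ‖v‖ = 1 ∧ ‖π v‖ ≤ 1 / ((n : ℝ) + 1) := by
    intro n
    have hpos : (0 : ℝ) < (n : ℝ) + 1 := by positivity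
    obtain ⟨q, hq, hqr, v, hv, hlt⟩ := hcon ((n : ℝ) + 1) hpos (1 / ((n : ℝ) + 1)) (by positivity)
    have hv0 : 0 < ‖v‖ := lt_of_le_of_lt (by positivity) hlt
    refine ⟨q, hq, hqr, ‖v‖⁻¹ • v, smul_mem_regularNormalCone (by positivity) hv, ?_, ?_⟩
    · rw [norm_smul, norm_inv, norm_norm, inv_mul_cancel₀ hv0.ne']
    · rw [map_smul, norm_smul, norm_inv, norm_norm, le_div_iff₀ hpos, mul_assoc,
        inv_mul_le_iff₀ hv0]
      linarith
  choose q hq hqr v hv hv1 hπ using hn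
  have : ProperSpace E := FiniteDimensional.proper_real E
  -- A cluster point of these unit normals is a unit limiting normal killed by `π`.
  obtain ⟨u, hu, φ, hφ, hlim⟩ := (isCompact_sphere (0 : E) 1).tendsto_subseq (x := v)
    (fun n => by simpa using hv1 n)
  have h0 := (tendsto_one_div_add_atTop_nhds_zero_nat (𝕜 := ℝ)).comp hφ.tendsto_atTop
  have hπu : π u = 0 := by
    refine tendsto_nhds_unique ((π.continuous.tendsto u).comp hlim) ?_
    exact squeeze_zero_norm (fun n => hπ (φ n)) h0
  have hu0 : u = 0 := by
    refine h u ⟨q ∘ φ, v ∘ φ, fun n => hq _, ?_, fun n => hv _, hlim⟩ hπu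
    rw [tendsto_iff_norm_sub_tendsto_zero]
    exact squeeze_zero (fun n => norm_nonneg _) (fun n => (hqr (φ n)).le) h0
  simp [hu0] at hu

end NormalCones

/-! ### Existence of nearby solutions by penalized minimization. -/

section Triple

variable {X Y Z : Type*} [NormedAddCommGroup X] [InnerProductSpace ℝ X]
  [NormedAddCommGroup Y] [InnerProductSpace ℝ Y] [NormedAddCommGroup Z] [InnerProductSpace ℝ Z]

/-- Away from its zero, the first root has a gradient of norm one in the `(x, z)` components. The
smoothing `ε` keeps the second root differentiable even at `q.fst.snd = y`, with gradient of norm at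
most one. -/
theorem exists_regularNormal_of_isLocalMinOn {A : Set (WithLp 2 (WithLp 2 (X × Y) × Z))}
    {q : WithLp 2 (WithLp 2 (X × Y) × Z)} {x : X} {y : Y} {lam ε : ℝ} (hlam : 0 ≤ lam) (hε : 0 < ε)
    (hmin : IsLocalMinOn (fun p : WithLp 2 (WithLp 2 (X × Y) × Z) =>
      √(‖p.fst.fst - x‖ ^ 2 + ‖p.snd‖ ^ 2) + lam * √(‖p.fst.snd - y‖ ^ 2 + ε ^ 2)) A q)
    (hq : ‖q.fst.fst - x‖ ^ 2 + ‖q.snd‖ ^ 2 ≠ 0) :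
    ∃ v ∈ regularNormalCone A q, 1 ≤ ‖v‖ ∧ ‖v.fst.snd‖ ≤ lam := by
  set g := ‖q.fst.fst - x‖ ^ 2 + ‖q.snd‖ ^ 2 with hg
  set h := ‖q.fst.snd - y‖ ^ 2 + ε ^ 2 with hh
  have hg0 : 0 < g := lt_of_le_of_ne (by positivity) hq.symm
  have hh0 : 0 < h := by positivity
  let cX : WithLp 2 (WithLp 2 (X × Y) × Z) →L[ℝ] X :=
    (WithLp.fstL 2 ℝ X Y).comp (WithLp.fstL 2 ℝ (WithLp 2 (X × Y)) Z)
  let cY : WithLp 2 (WithLp 2 (X × Y) × Z) →L[ℝ] Y :=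
    (WithLp.sndL 2 ℝ X Y).comp (WithLp.fstL 2 ℝ (WithLp 2 (X × Y)) Z)
  let cZ : WithLp 2 (WithLp 2 (X × Y) × Z) →L[ℝ] Z := WithLp.sndL 2 ℝ (WithLp 2 (X × Y)) Z
  have hder := (((cX.hasFDerivAt (x := q)).sub_const x).norm_sq.add
    (cZ.hasFDerivAt (x := q)).norm_sq).sqrt hq |>.add
    (((((cY.hasFDerivAt (x := q)).sub_const y).norm_sq.add_const (ε ^ 2)).sqrt hh0.ne').const_mul lam)
  refine ⟨WithLp.toLp 2 (WithLp.toLp 2 (-(√g)⁻¹ • (q.fst.fst - x),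
    -(lam * (√h)⁻¹) • (q.fst.snd - y)), -(√g)⁻¹ • q.snd),
    hmin.mem_regularNormalCone hder ?_, ?_, ?_⟩
  · intro w
    have e1 : cX q = q.fst.fst := rfl
    have e2 : cY q = q.fst.snd := rfl
    have e3 : cZ q = q.snd := rfl
    have f1 : cX w = w.fst.fst := rfl
    have f2 : cY w = w.fst.snd := rfl
    have f3 : cZ w = w.snd := rfl
    simp only [WithLp.prod_inner_apply, real_inner_smul_left, Pi.add_apply, add_apply,
      smul_apply, ContinuousLinearMap.comp_apply, innerSL_apply_apply,
      smul_eq_mul, e1, e2, e3, f1, f2, f3, nsmul_eq_mul,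
      ← hg, ← hh, Nat.cast_ofNat, WithLp.ofLp_fst, WithLp.ofLp_snd]
    have : √g ≠ 0 := (Real.sqrt_pos.2 hg0).ne'
    have : √h ≠ 0 := (Real.sqrt_pos.2 hh0).ne'
    field_simp
    ring
  · rw [← one_le_sq_iff₀ (norm_nonneg _), WithLp.prod_norm_sq_eq_of_L2,
      WithLp.prod_norm_sq_eq_of_L2]
    simp only [WithLp.toLp_fst, WithLp.toLp_snd, norm_smul, mul_pow, norm_neg, norm_inv,
      Real.norm_eq_abs, sq_abs, inv_pow, Real.sq_sqrt hg0.le]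
    have : g⁻¹ * ‖q.fst.fst - x‖ ^ 2 + g⁻¹ * ‖q.snd‖ ^ 2 = 1 := by
      rw [← mul_add, ← hg, inv_mul_cancel₀ hq]
    have : 0 ≤ |lam * (√h)⁻¹| ^ 2 * ‖q.fst.snd - y‖ ^ 2 := by positivity
    simp only [sq_abs, mul_pow, inv_pow] at this
    linarith
  · have hle : ‖q.fst.snd - y‖ ≤ √h := Real.le_sqrt_of_sq_le (by rw [hh]; nlinarith)
    have h1 : (√h)⁻¹ * ‖q.fst.snd - y‖ ≤ 1 := by
      rw [inv_mul_le_iff₀ (Real.sqrt_pos.2 hh0)]; linarith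
    simp only [WithLp.toLp_fst, WithLp.toLp_snd, norm_smul, norm_neg, norm_mul, norm_inv,
      Real.norm_eq_abs, abs_of_nonneg hlam, abs_of_nonneg (Real.sqrt_nonneg _), mul_assoc]
    nlinarith

/-- The sufficiency part of the Mordukhovich criterion, with the bound on the normals stated in a
neighbourhood of the reference point. -/
theorem exists_mem_fiber_of_regularNormalCone_bound [FiniteDimensional ℝ X]
    [FiniteDimensional ℝ Y] [FiniteDimensional ℝ Z]
    {A : Set (WithLp 2 (WithLp 2 (X × Y) × Z))} {p₀ p₁ : WithLp 2 (WithLp 2 (X × Y) × Z)}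
    {κ r lam : ℝ} (hκ : 0 < κ) (hlam : 0 < lam) (hκlam : κ * lam < 1)
    (hcl : IsClosed (A ∩ Metric.closedBall p₀ r))
    (hbd : ∀ q ∈ A, ‖q - p₀‖ < r → ∀ v ∈ regularNormalCone A q, ‖v‖ ≤ κ * ‖v.fst.snd‖)
    (hp₁ : p₁ ∈ A) (hz : p₁.snd = 0) (hp₁r : ‖p₁ - p₀‖ < r / 2) (x : X)
    (hx : ‖p₁.fst.fst - x‖ * (4 + 2 * lam + 1 / lam) < r / 2) :
    ∃ y : Y, WithLp.toLp 2 (WithLp.toLp 2 (x, y), 0) ∈ A ∧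
      ‖p₁.fst.snd - y‖ ≤ (1 / lam + 1) * ‖p₁.fst.fst - x‖ := by
  set d := ‖p₁.fst.fst - x‖ with hd
  -- The distance `d` also serves as smoothing parameter, so it must be positive; this gives `φ p₁ =
  -- (1 + lam) * d`.
  rcases (norm_nonneg (p₁.fst.fst - x)).eq_or_lt with h0 | hd0
  · have hx' : p₁.fst.fst = x := sub_eq_zero.1 (norm_eq_zero.1 h0.symm)
    refine ⟨p₁.fst.snd, ?_, ?_⟩
    · rw [← hx', ← hz]; exact hp₁
    · rw [hd, ← h0]; simp
  rw [← hd] at hd0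
  let φ : WithLp 2 (WithLp 2 (X × Y) × Z) → ℝ := fun p =>
      √(‖p.fst.fst - x‖ ^ 2 + ‖p.snd‖ ^ 2) + lam * √(‖p.fst.snd - p₁.fst.snd‖ ^ 2 + d ^ 2)
  have : ProperSpace (WithLp 2 (WithLp 2 (X × Y) × Z)) := FiniteDimensional.proper_real _
  have hcpt : IsCompact (A ∩ Metric.closedBall p₀ r) :=
    (isCompact_closedBall p₀ r).of_isClosed_subset hcl inter_subset_right
  have hφc : Continuous φ := by
    have h1 : Continuous fun p : WithLp 2 (WithLp 2 (X × Y) × Z) => p.fst :=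
      (WithLp.fstL 2 ℝ _ _).continuous
    have h2 : Continuous fun p : WithLp 2 (WithLp 2 (X × Y) × Z) => p.snd :=
      (WithLp.sndL 2 ℝ _ _).continuous
    have h3 : Continuous fun p : WithLp 2 (WithLp 2 (X × Y) × Z) => p.fst.fst :=
      (WithLp.fstL 2 ℝ X Y).continuous.comp h1
    have h4 : Continuous fun p : WithLp 2 (WithLp 2 (X × Y) × Z) => p.fst.snd :=
      (WithLp.sndL 2 ℝ X Y).continuous.comp h1
    fun_prop
  have hr : 0 < r := by linarith [norm_nonneg (p₁ - p₀)]
  have hp₁b : p₁ ∈ Metric.closedBall p₀ r := by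
    rw [mem_closedBall_iff_norm]; linarith
  obtain ⟨q, ⟨hqA, hqb⟩, hqmin⟩ := hcpt.exists_isMinOn ⟨p₁, hp₁, hp₁b⟩ hφc.continuousOn
  have hval : √(‖q.fst.fst - x‖ ^ 2 + ‖q.snd‖ ^ 2) +
      lam * √(‖q.fst.snd - p₁.fst.snd‖ ^ 2 + d ^ 2) ≤ d + lam * d := by
    have := hqmin ⟨hp₁, hp₁b⟩
    simpa [φ, hz, ← hd, Real.sqrt_sq hd0.le] using this
  have hx1 : ‖q.fst.fst - x‖ ≤ √(‖q.fst.fst - x‖ ^ 2 + ‖q.snd‖ ^ 2) :=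
    Real.le_sqrt_of_sq_le (by nlinarith)
  have hz1 : ‖q.snd‖ ≤ √(‖q.fst.fst - x‖ ^ 2 + ‖q.snd‖ ^ 2) :=
    Real.le_sqrt_of_sq_le (by nlinarith)
  have hy1 : ‖q.fst.snd - p₁.fst.snd‖ ≤ √(‖q.fst.snd - p₁.fst.snd‖ ^ 2 + d ^ 2) :=
    Real.le_sqrt_of_sq_le (by nlinarith)
  have hy2 : ‖q.fst.snd - p₁.fst.snd‖ ≤ (1 / lam + 1) * d := by
    have h1 : lam * ‖q.fst.snd - p₁.fst.snd‖ ≤ d + lam * d := by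
      nlinarith [norm_nonneg q.snd]
    have h2 : (1 / lam + 1) * d = (d + lam * d) / lam := by field_simp
    rw [h2, le_div_iff₀ hlam]
    linarith
  have hsq : 0 ≤ lam * √(‖q.fst.snd - p₁.fst.snd‖ ^ 2 + d ^ 2) := by positivity
  -- The terms `(1 + lam) * d + d`, `(1 / lam + 1) * d` and `(1 + lam) * d`, for `x`, `y` and `z`,
  -- add up to the constant in `hx`. Being strictly inside the ball makes `q` a local minimizer on
  -- `A`.
  have hqr : ‖q - p₀‖ < r := by
    have h1 : ‖q - p₁‖ ≤ ‖q.fst.fst - p₁.fst.fst‖ + ‖q.fst.snd - p₁.fst.snd‖ + ‖q.snd‖ := by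
      have a1 := norm_withLp_two_le (q - p₁)
      have a2 := norm_withLp_two_le (q - p₁).fst
      simp only [WithLp.sub_fst, WithLp.sub_snd, hz, sub_zero] at a1 a2
      linarith
    have h2 : ‖q.fst.fst - p₁.fst.fst‖ ≤ ‖q.fst.fst - x‖ + d := by
      rw [hd, norm_sub_rev p₁.fst.fst x]
      exact norm_sub_le_norm_sub_add_norm_sub _ _ _
    have h3 : ‖q - p₀‖ ≤ ‖q - p₁‖ + ‖p₁ - p₀‖ := norm_sub_le_norm_sub_add_norm_sub _ _ _
    nlinarith
  by_cases hg : ‖q.fst.fst - x‖ ^ 2 + ‖q.snd‖ ^ 2 = 0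
  · have hqx : ‖q.fst.fst - x‖ = 0 := by nlinarith [norm_nonneg (q.fst.fst - x), sq_nonneg ‖q.snd‖]
    have hqz : ‖q.snd‖ = 0 := by nlinarith [norm_nonneg q.snd, sq_nonneg ‖q.fst.fst - x‖]
    refine ⟨q.fst.snd, ?_, by rwa [norm_sub_rev]⟩
    rw [← sub_eq_zero.1 (norm_eq_zero.1 hqx), ← norm_eq_zero.1 hqz]
    exact hqA
  · exfalso
    have hloc : IsLocalMinOn φ A q := by
      have hnb : Metric.closedBall p₀ r ∈ 𝓝 q :=
        Filter.mem_of_superset (Metric.isOpen_ball.mem_nhds (by rwa [mem_ball_iff_norm]))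
          Metric.ball_subset_closedBall
      filter_upwards [self_mem_nhdsWithin, mem_nhdsWithin_of_mem_nhds hnb] with p h1 h2
      exact hqmin ⟨h1, h2⟩
    obtain ⟨v, hv, hv1, hvy⟩ := exists_regularNormal_of_isLocalMinOn hlam.le hd0 hloc hg
    have := hbd q hqA hqr v hv
    nlinarith

end Triple

/-! ### Passage from regular to limiting normals. -/

section LimitingNormals

variable {E F : Type*} [NormedAddCommGroup E] [InnerProductSpace ℝ E]
  [NormedAddCommGroup F] [InnerProductSpace ℝ F]

theorem norm_le_of_mem_limitingNormalCone {A : Set E} {x q v : E} {κ r : ℝ} (π : E →L[ℝ] F)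
    (hbd : ∀ q ∈ A, ‖q - x‖ < r → ∀ v ∈ regularNormalCone A q, ‖v‖ ≤ κ * ‖π v‖)
    (hq : ‖q - x‖ < r) (hv : v ∈ limitingNormalCone A q) : ‖v‖ ≤ κ * ‖π v‖ := by
  obtain ⟨p, u, hpA, hp, hu, huv⟩ := hv
  refine le_of_tendsto_of_tendsto huv.norm
    ((((π.continuous.tendsto v).comp huv).norm).const_mul κ) ?_
  filter_upwards [((hp.sub_const x).norm).eventually (gt_mem_nhds hq)] with n hn
  exact hbd _ (hpA n) hn _ (hu n)

theorem SemismoothStarSetAt.exists_abs_inner_le {A : Set E} {x : E}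
    (h : SemismoothStarSetAt A x) {ε : ℝ} (hε : 0 < ε) :
    ∃ δ > 0, ∀ q, ‖q - x‖ < δ → ∀ v ∈ limitingNormalCone A q,
      |inner ℝ v (q - x)| ≤ ε * ‖q - x‖ * ‖v‖ := by
  obtain ⟨δ, hδ, hA⟩ := h ε hε
  refine ⟨δ, hδ, fun q hq v ⟨p, u, hpA, hp, hu, huv⟩ => ?_⟩
  have hpx := hp.sub_const x
  refine le_of_tendsto_of_tendsto (huv.inner hpx).abs ((hpx.norm.const_mul ε).mul huv.norm) ?_
  filter_upwards [hpx.norm.eventually (gt_mem_nhds hq)] with n hn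
  exact hA _ ⟨hpA n, by rw [mem_closedBall_iff_norm]; exact hn.le⟩ _ (hu n)

/-- The projections of `m` onto the approximating subspaces converge to `m`, and each yields a
regular normal after the swap with sign. -/
theorem limitingNormal_of_mem_scLimitingCoderivative [FiniteDimensional ℝ E]
    [FiniteDimensional ℝ F] {S : E → Set F} {x : E} {y : F} {L : Submodule ℝ (WithLp 2 (F × E))}
    (hL : L ∈ scLimitingCoderivative S x y) {m : WithLp 2 (F × E)} (hm : m ∈ L) :
    WithLp.toLp 2 (m.snd, -m.fst) ∈ limitingNormalCone (setGraph S) (WithLp.toLp 2 (x, y)) := by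
  obtain ⟨-, p, M, hp, hlim, hM, hdist⟩ := hL
  have hmem : ∀ n, (M n).starProjection m ∈ M n := fun n => (M n).starProjection_apply_mem m
  have htend : Tendsto (fun n => (M n).starProjection m) atTop (𝓝 m) := by
    rw [tendsto_iff_norm_sub_tendsto_zero]
    refine squeeze_zero (fun n => norm_nonneg _) (fun n => ?_) (by simpa using hdist.mul_const ‖m‖)
    have h1 : L.starProjection m = m := Submodule.starProjection_eq_self_iff.2 hm
    calc ‖(M n).starProjection m - m‖ = ‖(L.starProjection - (M n).starProjection) m‖ := by
          rw [sub_apply, h1, norm_sub_rev]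
      _ ≤ subspaceDist L (M n) * ‖m‖ := ContinuousLinearMap.le_opNorm _ _
  refine ⟨p, fun n => WithLp.toLp 2 (((M n).starProjection m).snd, -((M n).starProjection m).fst),
    fun n => (hp n).1, hlim, fun n => ?_, ?_⟩
  · have h1 : (M n).starProjection m ∈ (M n : Set (WithLp 2 (F × E))) := hmem n
    rw [hM n] at h1
    exact h1
  · have hc : Continuous fun m : WithLp 2 (F × E) => WithLp.toLp 2 (m.snd, -m.fst) :=
      (WithLp.prod_continuous_toLp 2 E F).comp
        ((WithLp.sndL 2 ℝ F E).continuous.prodMk (WithLp.fstL 2 ℝ F E).continuous.neg)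
    exact (hc.tendsto m).comp htend

end LimitingNormals

/-! ### The two stability properties of the solution map. -/

section SolutionMap

variable {X Y Z : Type*} [NormedAddCommGroup X] [InnerProductSpace ℝ X]
  [NormedAddCommGroup Y] [InnerProductSpace ℝ Y] [NormedAddCommGroup Z] [InnerProductSpace ℝ Z]
  [FiniteDimensional ℝ X] [FiniteDimensional ℝ Y] [FiniteDimensional ℝ Z]

theorem aubinPropertyAround_implicitSolutionMap {H : WithLp 2 (X × Y) → Set Z} {x : X} {y : Y}
    {κ r : ℝ} (hκ : 0 < κ) (hr : 0 < r)
    (hclosed : LocallyClosedAround (setGraph H) (WithLp.toLp 2 (WithLp.toLp 2 (x, y), 0)))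
    (hbd : ∀ q ∈ setGraph H, ‖q - WithLp.toLp 2 (WithLp.toLp 2 (x, y), 0)‖ < r →
      ∀ v ∈ regularNormalCone (setGraph H) q, ‖v‖ ≤ κ * ‖v.fst.snd‖) :
    AubinPropertyAround (implicitSolutionMap H) x y := by
  obtain ⟨s, hs, hsr, hcl⟩ := hclosed.exists_isClosed_inter_closedBall hr
  set lam := 1 / (2 * κ) with hlam_def
  have hlam : 0 < lam := by positivity
  have hκlam : κ * lam < 1 := by
    have : κ * lam = 1 / 2 := by rw [hlam_def]; field_simp
    linarith
  set c := 4 + 2 * lam + 1 / lam with hc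
  have hc4 : 4 < c := by
    have : 0 < 1 / lam := by positivity
    linarith
  have hη : 0 < s / (8 * c) := by positivity
  have hηc : s / (8 * c) * c = s / 8 := by field_simp
  -- With radius `s / (8 * c)`, `‖x₁ - x₂‖ * c < s / 4`, and `c > 4` keeps the starting point within
  -- `s / 2` of the centre.
  refine ⟨1 / lam + 1, by positivity, Metric.ball x (s / (8 * c)), Metric.ball_mem_nhds _ hη,
    Metric.ball y (s / (8 * c)), Metric.ball_mem_nhds _ hη, ?_⟩
  rintro x₁ hx₁ x₂ hx₂ y₁ ⟨hy₁, hy₁U⟩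
  rw [mem_ball_iff_norm] at hx₁ hx₂ hy₁U
  have hd : ‖x₁ - x₂‖ < 2 * (s / (8 * c)) := by
    have := norm_sub_le_norm_sub_add_norm_sub x₁ x x₂
    rw [norm_sub_rev x x₂] at this
    linarith
  refine exists_mem_fiber_of_regularNormalCone_bound (p₁ := WithLp.toLp 2 (WithLp.toLp 2 (x₁, y₁), 0))
    hκ hlam hκlam hcl (fun q hq hqs => hbd q hq (hqs.trans_le hsr)) hy₁ rfl ?_ x₂ ?_
  · have := norm_toLp_toLp_zero_sub_le (Z := Z) x₁ x y₁ y
    nlinarith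
  · change ‖x₁ - x₂‖ * c < s / 2
    nlinarith

theorem exists_limitingNormal_of_scdAt (hYZ : Module.finrank ℝ Z = Module.finrank ℝ Y)
    {H : WithLp 2 (X × Y) → Set Z} {q : WithLp 2 (WithLp 2 (X × Y) × Z)}
    (hq : SCDAt H q.fst q.snd)
    (hker : ∀ v ∈ limitingNormalCone (setGraph H) q, v.fst.snd = 0 → v = 0) (y : Y) :
    ∃ v ∈ limitingNormalCone (setGraph H) q, v.fst.snd = y := by
  obtain ⟨L, hL⟩ := hq
  let T : L →ₗ[ℝ] Y := ((WithLp.sndL 2 ℝ X Y).comp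
    (WithLp.sndL 2 ℝ Z (WithLp 2 (X × Y)))).toLinearMap.comp L.subtype
  have hT : ∀ m : L, T m = m.1.snd.snd := fun m => rfl
  have hinj : Function.Injective T := by
    rw [injective_iff_map_eq_zero]
    intro m hm
    have h0 := hker _ (limitingNormal_of_mem_scLimitingCoderivative hL m.2) hm
    have h1 : m.1.snd = 0 := congrArg WithLp.fst h0
    have h2 : m.1.fst = 0 := neg_eq_zero.1 (congrArg WithLp.snd h0)
    have h3 := norm_withLp_two_le m.1
    rw [h1, h2, norm_zero, norm_zero, add_zero] at h3
    exact Subtype.ext (norm_le_zero_iff.1 h3)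
  obtain ⟨m, hm⟩ := (LinearMap.injective_iff_surjective_of_finrank_eq_finrank
    (hL.1.trans hYZ)).1 hinj y
  exact ⟨_, limitingNormal_of_mem_scLimitingCoderivative hL m.2, hm⟩

theorem isolatedlyCalmAround_implicitSolutionMap (hYZ : Module.finrank ℝ Z = Module.finrank ℝ Y)
    {H : WithLp 2 (X × Y) → Set Z} {x : X} {y : Y} {κ r : ℝ} (hκ : 0 < κ) (hr : 0 < r)
    (hbd : ∀ q ∈ setGraph H, ‖q - WithLp.toLp 2 (WithLp.toLp 2 (x, y), 0)‖ < r →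
      ∀ v ∈ regularNormalCone (setGraph H) q, ‖v‖ ≤ κ * ‖v.fst.snd‖)
    (hscd : SCDAround H (WithLp.toLp 2 (x, y)) 0)
    (hss : SemismoothStarAround H (WithLp.toLp 2 (x, y)) 0) :
    IsolatedlyCalmAround (implicitSolutionMap H) x y := by
  obtain ⟨W₁, hW₁, hscd⟩ := hscd
  obtain ⟨W₂, hW₂, hss⟩ := hss
  let ι : WithLp 2 (X × Y) → WithLp 2 (WithLp 2 (X × Y) × Z) := fun p => WithLp.toLp 2 (p, 0)
  have hι : Continuous ι :=
    (WithLp.prod_continuous_toLp 2 (WithLp 2 (X × Y)) Z).comp (continuous_id.prodMk continuous_const)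
  -- Openness keeps both `p` and the nearby comparison point `q` inside: semismoothness* is used at
  -- `p`, SCD and the bound at `q`.
  let G := interior (Metric.ball (ι (WithLp.toLp 2 (x, y))) r ∩ (W₁ ∩ W₂))
  have hG : G ∈ 𝓝 (ι (WithLp.toLp 2 (x, y))) :=
    interior_mem_nhds.2 (inter_mem (Metric.ball_mem_nhds _ hr) (inter_mem hW₁ hW₂))
  refine ⟨2 * κ + 1, by positivity, ι ⁻¹' G, hι.continuousAt hG, ?_⟩
  rintro p ⟨hpS, hpG : ι p ∈ G⟩
  have hp : p = WithLp.toLp 2 (p.fst, p.snd) := rfl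
  have hpH : ι p ∈ setGraph H := hpS
  -- With `‖v‖ ≤ κ * b`, the choice `1 / (2 * κ)` bounds the error by `(a + b) * b / 2`, so half of
  -- `b ^ 2` survives.
  obtain ⟨δ, hδ, hδss⟩ := (hss _ ⟨hpH, (interior_subset hpG).2.2⟩).exists_abs_inner_le
    (show 0 < 1 / (2 * κ) by positivity)
  obtain ⟨ρ, hρ, hρG⟩ := Metric.isOpen_iff.1 isOpen_interior _ hpG
  set η := min δ ρ / 2 with hη_def
  have hη : 0 < η := by positivity
  refine ⟨Metric.ball p.snd η, Metric.ball_mem_nhds _ hη, fun x' y' ⟨hy', hyη⟩ => ?_⟩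
  rw [mem_ball_iff_norm] at hyη
  -- Calmness ranges over all `x'`; far away, `‖y' - p.snd‖ < η ≤ ‖x' - p.fst‖` suffices.
  rcases le_or_gt η ‖x' - p.fst‖ with hfar | hnear
  · nlinarith [norm_nonneg (x' - p.fst)]
  set q : WithLp 2 (WithLp 2 (X × Y) × Z) := WithLp.toLp 2 (WithLp.toLp 2 (x', y'), 0) with hq_def
  have hqH : q ∈ setGraph H := hy'
  have hqp : ‖q - ι p‖ ≤ ‖x' - p.fst‖ + ‖y' - p.snd‖ :=
    norm_toLp_toLp_zero_sub_le x' p.fst y' p.snd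
  have hqm : ‖q - ι p‖ < min δ ρ := by linarith
  have hqG := interior_subset (hρG (mem_ball_iff_norm.2 (hqm.trans_le (min_le_right _ _))))
  let π : WithLp 2 (WithLp 2 (X × Y) × Z) →L[ℝ] Y :=
    (WithLp.sndL 2 ℝ X Y).comp (WithLp.fstL 2 ℝ (WithLp 2 (X × Y)) Z)
  have hlim : ∀ v ∈ limitingNormalCone (setGraph H) q, ‖v‖ ≤ κ * ‖v.fst.snd‖ := fun v hv =>
    norm_le_of_mem_limitingNormalCone π hbd (mem_ball_iff_norm.1 hqG.1) hv
  obtain ⟨v, hv, hvy⟩ := exists_limitingNormal_of_scdAt hYZ (hscd q ⟨hqH, hqG.2.1⟩)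
    (fun v hv h0 => norm_le_zero_iff.1 (by simpa [h0] using hlim v hv)) (y' - p.snd)
  have hvn := hlim v hv
  rw [hvy] at hvn
  have hinner := (le_abs_self _).trans (hδss q (hqm.trans_le (min_le_left _ _)) v hv)
  have hexp : inner ℝ v (q - ι p) = inner ℝ v.fst.fst (x' - p.fst) + ‖y' - p.snd‖ ^ 2 := by
    rw [WithLp.prod_inner_apply, WithLp.prod_inner_apply, ← real_inner_self_eq_norm_sq]
    simp [q, ι, ← hvy]
  have hu : ‖v.fst.fst‖ ≤ κ * ‖y' - p.snd‖ :=
    ((norm_fst_le_norm_withLp_two _).trans (norm_fst_le_norm_withLp_two _)).trans hvn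
  have hCS := neg_le_of_abs_le (abs_real_inner_le_norm v.fst.fst (x' - p.fst))
  rw [hexp] at hinner
  set a := ‖x' - p.fst‖
  set b := ‖y' - p.snd‖
  have ha : 0 ≤ a := norm_nonneg _
  have hb : 0 ≤ b := norm_nonneg _
  have h1 : 1 / (2 * κ) * ‖q - ι p‖ * ‖v‖ ≤ (a + b) * b / 2 := by
    calc 1 / (2 * κ) * ‖q - ι p‖ * ‖v‖ ≤ 1 / (2 * κ) * (a + b) * (κ * b) := by gcongr
      _ = (a + b) * b / 2 := by field_simp
  have h2 : ‖v.fst.fst‖ * a ≤ κ * b * a := mul_le_mul_of_nonneg_right hu ha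
  have h3 : b * b ≤ (2 * κ + 1) * a * b := by nlinarith
  rcases hb.eq_or_lt with hb0 | hb0
  · rw [← hb0]; positivity
  · exact le_of_mul_le_mul_right h3 hb0

end SolutionMap

theorem proposition5p8 (l k : ℕ)
    (H : WithLp 2 (EuclideanSpace ℝ (Fin l) × EuclideanSpace ℝ (Fin k)) →
      Set (EuclideanSpace ℝ (Fin k)))
    (xbar : EuclideanSpace ℝ (Fin l)) (ybar : EuclideanSpace ℝ (Fin k))
    (hmem : 0 ∈ H (WithLp.toLp 2 (xbar, ybar)))
    (hclosed : LocallyClosedAround (setGraph H)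
      (WithLp.toLp 2 (WithLp.toLp 2 (xbar, ybar), 0)))
    (hcod : ∀ (wstar : EuclideanSpace ℝ (Fin k)) (ustar : EuclideanSpace ℝ (Fin l)),
      WithLp.toLp 2 (ustar, 0) ∈
        limitingCoderivative H (WithLp.toLp 2 (xbar, ybar)) 0 wstar →
      wstar = 0 ∧ ustar = 0) :
    AubinPropertyAround (implicitSolutionMap H) xbar ybar ∧
      (SCDAround H (WithLp.toLp 2 (xbar, ybar)) 0 →
        SemismoothStarAround H (WithLp.toLp 2 (xbar, ybar)) 0 →
        IsolatedlyCalmAround (implicitSolutionMap H) xbar ybar) := by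
  obtain ⟨κ, hκ, r, hr, hbd⟩ := exists_norm_le_of_regularNormalCone (A := setGraph H)
    (x := WithLp.toLp 2 (WithLp.toLp 2 (xbar, ybar), 0))
    ((WithLp.sndL 2 ℝ (EuclideanSpace ℝ (Fin l)) (EuclideanSpace ℝ (Fin k))).comp
      (WithLp.fstL 2 ℝ (WithLp 2 (EuclideanSpace ℝ (Fin l) × EuclideanSpace ℝ (Fin k)))
        (EuclideanSpace ℝ (Fin k)))) (by
      intro v hv h0
      have h0' : v.fst.snd = 0 := h0
      have hv' : v = WithLp.toLp 2 (WithLp.toLp 2 (v.fst.fst, 0), - -v.snd) := by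
        rw [neg_neg, ← h0']; rfl
      rw [hv'] at hv
      obtain ⟨h1, h2⟩ := hcod (-v.snd) v.fst.fst hv
      rw [hv', h1, h2]
      simp)
  exact ⟨aubinPropertyAround_implicitSolutionMap hκ hr hclosed hbd,
    isolatedlyCalmAround_implicitSolutionMap rfl hκ hr hbd⟩
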